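/- Let $X$ be a Tychonoff space, and let $C(X)$ be the real vector space of all continuous functions $X\to\mathbb{R}$. Write $C_p(X)$ for $C(X)$ with the topology of pointwise convergence and $C_k(X)$ for $C(X)$ with the compact-open topology. The following conditions are equivalent: 1. $C_p(X)$ is Polishable, that is, there is a topology on $C(X)$, finer than or equal to the topology of pointwise convergence, which makes $C(X)$ a separable Fréchet space (a separable, complete, metrizable, locally convex topological vector space); 2. $C_k(X)$ is a Polish space (separable and completely metrizable); 3. $X$ is a submetrizable hemicompact $k$-space. Here $X$ is *submetrizable* if there is a metric on the set $X$ which is continuous as a function on $X\times X$; *hemicompact* if there is a countable family $\mathcal{K}$ of compact subsets of $X$ such that each compact subset of $X$ is contained in some $K\in\mathcal{K}$; and a *$k$-space* if a subset $F\subseteq X$ is closed if and only if $F\cap K$ is closed in $K$ for every compact subset $K\subseteq X$. -/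

import Mathlib

namespace FunctionSpace

/-- A Fréchet (locally convex) space: a real topological vector space that is locally convex,
metrizable, and complete for its canonical uniformity, in which `x` and `y` are close when
`y - x` is close to `0`. -/
structure IsFrechet (E : Type*) [AddCommGroup E] [Module ℝ E] [TopologicalSpace E] : Prop where
  isTopologicalAddGroup : IsTopologicalAddGroup E
  continuousSMul : ContinuousSMul ℝ E
  locallyConvexSpace : LocallyConvexSpace ℝ E
  metrizableSpace : TopologicalSpace.MetrizableSpace E
  completeSpace : @CompleteSpace E (IsTopologicalAddGroup.rightUniformSpace E)

/-- A real vector space `E` with the topology `t` is Polishable if there is on `E` a topology `τ`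
which is finer than (or equal to) `t` and makes `E` a separable Fréchet space. -/
def IsPolishable (E : Type*) [AddCommGroup E] [Module ℝ E] (t : TopologicalSpace E) : Prop :=
  ∃ τ : TopologicalSpace E, τ ≤ t ∧ @IsFrechet E _ _ τ ∧ @TopologicalSpace.SeparableSpace E τ

/-- The topology of pointwise convergence on the vector space of continuous real-valued functions
on `X`, that is, the subspace topology from the product `ℝ ^ X`. (The global topology instance on
`C(X, ℝ)` is the compact-open topology.) -/
abbrev pointwiseTopology (X : Type*) [TopologicalSpace X] : TopologicalSpace C(X, ℝ) :=
  TopologicalSpace.induced (fun (f : C(X, ℝ)) (x : X) => f x) Pi.topologicalSpace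

/-- `X` is submetrizable: there is a metric `d` on the set `X` that is continuous as a function on
the product `X × X`. (Nonnegativity of `d` follows from the other axioms.) -/
def IsSubmetrizable (X : Type*) [TopologicalSpace X] : Prop :=
  ∃ d : X → X → ℝ, Continuous (fun p : X × X => d p.1 p.2) ∧
    (∀ x y, d x y = 0 ↔ x = y) ∧ (∀ x y, d x y = d y x) ∧ ∀ x y z, d x z ≤ d x y + d y z

/-- `X` is hemicompact: there is a countable family of compact sets such that each compact subset
of `X` is contained in a member of the family. -/
def IsHemicompact (X : Type*) [TopologicalSpace X] : Prop :=
  ∃ 𝒦 : Set (Set X), 𝒦.Countable ∧ (∀ K ∈ 𝒦, IsCompact K) ∧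
    ∀ C : Set X, IsCompact C → ∃ K ∈ 𝒦, C ⊆ K

/-- `X` is a k-space: a set `F` is closed if and only if `F ∩ K` is closed in `K` for every
compact `K`. -/
def IsKSpace (X : Type*) [TopologicalSpace X] : Prop :=
  ∀ F : Set X, IsClosed F ↔
    ∀ K : Set X, IsCompact K → IsClosed ((fun x : K => (x : X)) ⁻¹' F)

end FunctionSpace

/-! Let `τ` be a separable Fréchet topology on `C(X)` finer than the pointwise one, and let `U n` be
a decreasing base at `0`. The sets `K n` of points `x` with `|e x| ≤ 1` for all `e ∈ U n` control
`X`. They cover `X` because evaluations are continuous. A countable dense set approximates every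
function uniformly on `K n`, so `K n` is second countable and `X` is hereditarily Lindelöf.
Functions are bounded on `K n`, hence `K n` is compact. Barrelledness puts every compact set inside
some `K n`. A dense sequence also separates points, whence a continuous metric.

The k-space property is the hard part: functions that stabilize on the `K n` must glue to a
continuous function. They form a `τ`-Cauchy sequence, since every continuous seminorm has compact
support (`exists_support_of_seminorm`, fed by the closed graph theorem), and the `τ`-limit is the
glued function.

Conversely, over a submetrizable hemicompact k-space, `C_k(X)` is determined by countably many
separable spaces `C(K)`, and uniform limits on compact sets are continuous. If `C_k(X)` is Polish,
its own topology witnesses Polishability, by Klee's theorem. -/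

namespace FunctionSpace

/-! ### Completeness of completely metrizable groups. -/

open Filter Set Topology Uniformity

/-- The range of a dense embedding of a completely metrizable space is a `Gδ` set. -/
theorem isGδ_range_of_isDenseInducing {G Y : Type*} [TopologicalSpace G]
    [TopologicalSpace.IsCompletelyMetrizableSpace G] [TopologicalSpace Y] [T2Space Y] {e : G → Y}
    (he : IsDenseInducing e) : IsGδ (range e) := by
  let _ := TopologicalSpace.upgradeIsCompletelyMetrizable G
  -- `O n` collects the points near which the inverse of `e` oscillates by less than `1 / (n + 1)`.
  let O : ℕ → Set Y := fun n => ⋃₀ {U | IsOpen U ∧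
    ∀ a b, e a ∈ U → e b ∈ U → dist a b < 1 / ((n : ℝ) + 1)}
  have hO : range e = ⋂ n, O n := by
    apply Subset.antisymm
    · rintro _ ⟨g, rfl⟩
      refine mem_iInter.2 fun n => ?_
      have hpos : (0 : ℝ) < 1 / ((n : ℝ) + 1) / 2 := by positivity
      obtain ⟨U, hU, hUe⟩ := he.toIsInducing.isOpen_iff.1 (Metric.isOpen_ball (x := g)
        (ε := 1 / ((n : ℝ) + 1) / 2))
      refine mem_sUnion.2 ⟨U, ⟨hU, fun a b ha hb => ?_⟩, ?_⟩
      · have ha' : a ∈ Metric.ball g (1 / ((n : ℝ) + 1) / 2) := hUe ▸ ha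
        have hb' : b ∈ Metric.ball g (1 / ((n : ℝ) + 1) / 2) := hUe ▸ hb
        have := dist_triangle_right a b g
        rw [Metric.mem_ball] at ha' hb'
        linarith
      · change g ∈ e ⁻¹' U
        rw [hUe]
        exact Metric.mem_ball_self hpos
    · intro z hz
      have hne : (comap e (𝓝 z)).NeBot := he.comap_nhds_neBot z
      have hC : Cauchy (comap e (𝓝 z)) := by
        refine Metric.cauchy_iff.2 ⟨hne, fun ε hε => ?_⟩
        obtain ⟨n, hn⟩ := exists_nat_one_div_lt hε
        obtain ⟨U, ⟨hU, hd⟩, hzU⟩ := mem_sUnion.1 (mem_iInter.1 hz n)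
        exact ⟨e ⁻¹' U, preimage_mem_comap (hU.mem_nhds hzU),
          fun a ha b hb => (hd a b ha hb).trans hn⟩
      obtain ⟨g, hg⟩ := CompleteSpace.complete hC
      exact ⟨g, tendsto_nhds_unique ((he.continuous.tendsto g).mono_left hg) tendsto_comap⟩
  rw [hO]
  exact IsGδ.iInter_of_isOpen fun n => isOpen_sUnion fun U hU => hU.1

/-- **Klee's theorem**: a completely metrizable abelian group is complete. -/
theorem completeSpace_of_isCompletelyMetrizableSpace {G : Type*} [AddCommGroup G] [UniformSpace G]
    [IsUniformAddGroup G] [TopologicalSpace.IsCompletelyMetrizableSpace G] :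
    CompleteSpace G := by
  have hcg : (𝓤 G).IsCountablyGenerated := IsUniformAddGroup.uniformity_countably_generated
  let c : G → UniformSpace.Completion G := fun x => (x : UniformSpace.Completion G)
  have hdi : IsDenseInducing c := UniformSpace.Completion.isDenseInducing_coe
  have hcg' : (𝓤 (UniformSpace.Completion G)).IsCountablyGenerated := by
    have : (𝓝 (0 : UniformSpace.Completion G)).IsCountablyGenerated := by
      obtain ⟨b, hb⟩ := (𝓝 (0 : G)).exists_antitone_basis
      exact (hb.1.hasBasis_of_isDenseInducing hdi).isCountablyGenerated
    exact IsUniformAddGroup.uniformity_countably_generated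
  have hG : IsGδ (range c) := isGδ_range_of_isDenseInducing hdi
  have hd : Dense (range c) := hdi.dense
  have hsurj : Function.Surjective c := by
    intro z
    -- By Baire the dense `Gδ` sets `range c` and `z - range c` meet, so `z` is a sum of two
    -- elements of the subgroup `range c`.
    have hG' : IsGδ ((fun y => z - y) ⁻¹' range c) := hG.preimage (by fun_prop)
    have hd' : Dense ((fun y => z - y) ⁻¹' range c) :=
      hd.preimage (Homeomorph.subLeft z).isOpenMap
    obtain ⟨_, ⟨a, rfl⟩, b, hb⟩ := (Dense.inter_of_Gδ hG hG' hd hd').nonempty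
    refine ⟨a + b, ?_⟩
    have hb' : c b = z - c a := hb
    have : c (a + b) = c a + c b := UniformSpace.Completion.coe_add a b
    rw [this, hb']
    abel
  exact ((UniformSpace.Completion.isUniformInducing_coe G).completeSpace_congr hsurj).2 inferInstance

/-! ### The closed graph theorem. -/

section ClosedGraph

variable {B E : Type*} [NormedAddCommGroup B] [NormedSpace ℝ B] [CompleteSpace B]
  [AddCommGroup E] [Module ℝ E] [UniformSpace E] [IsUniformAddGroup E] [ContinuousSMul ℝ E]

/-- Dilates of `T ⁻¹' W` cover `B` because `W` is absorbing, so Baire gives an interior point of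
`closure (T ⁻¹' W)`; subtracting it moves the neighbourhood to `0`. -/
theorem closure_preimage_mem_nhds_zero (T : B →ₗ[ℝ] E) {V : Set E} (hV : V ∈ 𝓝 0) :
    closure (T ⁻¹' V) ∈ 𝓝 0 := by
  obtain ⟨W, hW, hWV⟩ : ∃ W ∈ 𝓝 (0 : E), ∀ v ∈ W, ∀ w ∈ W, v - w ∈ V := exists_nhds_half_neg hV
  have hcover : ⋃ n : ℕ, closure ((fun b : B => ((n : ℝ) + 1)⁻¹ • b) ⁻¹' (T ⁻¹' W)) = univ := by
    refine eq_univ_of_forall fun b => mem_iUnion.2 ?_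
    have h0 : Tendsto (fun n : ℕ => ((n : ℝ) + 1)⁻¹ • T b) atTop (𝓝 0) := by
      have := (tendsto_one_div_add_atTop_nhds_zero_nat (𝕜 := ℝ)).smul_const (T b)
      simpa using this
    obtain ⟨n, hn⟩ := (h0.eventually hW).exists
    exact ⟨n, subset_closure (by simpa using! hn)⟩
  obtain ⟨n, x, hx⟩ := nonempty_interior_of_iUnion_of_closed (fun n => isClosed_closure) hcover
  have hn : ((n : ℝ) + 1) ≠ 0 := by positivity
  let e : B ≃ₜ B := Homeomorph.smulOfNeZero _ hn
  have hy : (e.symm x) ∈ interior (closure (T ⁻¹' W)) := by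
    have h1 : (fun b : B => ((n : ℝ) + 1)⁻¹ • b) ⁻¹' (T ⁻¹' W) = e.symm ⁻¹' (T ⁻¹' W) := rfl
    rw [h1, ← e.symm.preimage_closure, ← e.symm.preimage_interior] at hx
    exact hx
  set y := e.symm x
  have hnhds : (fun b => y - b) ⁻¹' (interior (closure (T ⁻¹' W))) ∈ 𝓝 (0 : B) :=
    (isOpen_interior.preimage (by fun_prop)).mem_nhds (by simpa using hy)
  refine mem_of_superset hnhds fun b hb => ?_
  have h1 : y - b ∈ closure (T ⁻¹' W) := interior_subset hb
  have h2 : y ∈ closure (T ⁻¹' W) := interior_subset hy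
  have h3 : y - (y - b) ∈ closure (T ⁻¹' V) :=
    map_mem_closure₂ continuous_sub h2 h1 fun p hp q hq => by
      simpa using hWV _ hp _ hq
  simpa using h3

/-- **Closed graph theorem** for a linear map from a Banach space to a complete, first countable
topological vector space. -/
theorem continuous_of_seq_closed_graph [CompleteSpace E] [FirstCountableTopology E]
    (T : B →ₗ[ℝ] E)
    (hT : ∀ (u : ℕ → B) (b : B) (e : E), Tendsto u atTop (𝓝 b) →
      Tendsto (fun n => T (u n)) atTop (𝓝 e) → e = T b) : Continuous T := by
  refine continuous_of_continuousAt_zero T ?_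
  have hcg : (𝓤 E).IsCountablyGenerated := IsUniformAddGroup.uniformity_countably_generated
  rw [ContinuousAt, map_zero]
  intro V hV
  obtain ⟨V', hV', hVc, hVV⟩ := exists_mem_nhds_isClosed_subset hV
  obtain ⟨b, hb⟩ := (𝓝 (0 : E)).exists_antitone_basis
  have hhalf : ∀ U ∈ 𝓝 (0 : E), ∃ W ∈ 𝓝 (0 : E), ∀ v ∈ W, ∀ w ∈ W, v + w ∈ U :=
    fun U hU => exists_nhds_zero_half hU
  choose! half hhalf_mem hhalf_add using hhalf
  -- `W (n + 1) + W (n + 1) ⊆ W n` controls sums of corrections; `W (n + 1) ⊆ b n` makes them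
  -- Cauchy.
  let W : ℕ → Set E := fun n => Nat.rec V' (fun n U => half U ∩ b n) n
  have hW : ∀ n, W n ∈ 𝓝 (0 : E) := fun n => by
    induction n with
    | zero => exact hV'
    | succ n ih => exact inter_mem (hhalf_mem _ ih) (hb.1.mem_of_mem trivial)
  have hWadd : ∀ n, ∀ v ∈ W (n + 1), ∀ w ∈ W (n + 1), v + w ∈ W n :=
    fun n v hv w hw => hhalf_add _ (hW n) v hv.1 w hw.1
  have hWb : ∀ n, W (n + 1) ⊆ b n := fun n => inter_subset_right
  have hmono : ∀ n, W (n + 1) ⊆ W n := fun n v hv => by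
    simpa using hWadd n v hv 0 (mem_of_mem_nhds (hW (n + 1)))
  have hanti : Antitone W := antitone_nat_of_succ_le hmono
  have hstep : ∀ (n : ℕ) (x : B), x ∈ closure (T ⁻¹' W n) → ∃ y, T y ∈ W n ∧
      x - y ∈ closure (T ⁻¹' W (n + 1)) ∧ ‖x - y‖ < 1 / ((n : ℝ) + 1) := by
    intro n x hx
    have hpos : (0 : ℝ) < 1 / ((n : ℝ) + 1) := by positivity
    have hN : (fun y => x - y) ⁻¹' (closure (T ⁻¹' W (n + 1)) ∩
        Metric.ball 0 (1 / ((n : ℝ) + 1))) ∈ 𝓝 x := by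
      have hc : Tendsto (fun y => x - y) (𝓝 x) (𝓝 0) := by
        have : Continuous fun y : B => x - y := by fun_prop
        simpa using this.tendsto x
      exact hc (inter_mem (closure_preimage_mem_nhds_zero T (hW (n + 1))) (Metric.ball_mem_nhds _ hpos))
    obtain ⟨y, hy, hyT⟩ := mem_closure_iff_nhds.1 hx _ hN
    exact ⟨y, hyT, hy.1, by simpa using hy.2⟩
  choose! g hgW hgcl hgn using hstep
  change T ⁻¹' V ∈ 𝓝 0
  refine mem_of_superset (closure_preimage_mem_nhds_zero T (hW 1)) fun x hx => hVV ?_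
  -- Remainders of a series for `x` with `n`-th term in `T ⁻¹' W (n + 1)`. Starting at `W 1` keeps
  -- the images of all partial sums in `W 0 = V'`, which is closed.
  let r : ℕ → B := fun n => Nat.rec x (fun n z => z - g (n + 1) z) n
  have hr : ∀ n, r n ∈ closure (T ⁻¹' W (n + 1)) := fun n => by
    induction n with
    | zero => exact hx
    | succ n ih => exact hgcl (n + 1) _ ih
  have hrs : ∀ n, r (n + 1) = r n - g (n + 1) (r n) := fun n => rfl
  have hrn : ∀ n, ‖r (n + 1)‖ < 1 / ((n : ℝ) + 1) := fun n => by
    refine (hgn (n + 1) (r n) (hr n)).trans_le ?_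
    push_cast
    gcongr
    linarith
  have hr0 : Tendsto r atTop (𝓝 0) := by
    rw [← tendsto_add_atTop_iff_nat 1]
    exact squeeze_zero_norm (fun n => (hrn n).le) tendsto_one_div_add_atTop_nhds_zero_nat
  let s : ℕ → B := fun n => x - r n
  have hs : Tendsto s atTop (𝓝 x) := by simpa using tendsto_const_nhds.sub hr0
  have hsT : ∀ n k, T (s (n + k)) - T (s n) ∈ W n := by
    have key : ∀ k n, T (s (n + k)) - T (s n) ∈ W n := by
      intro k
      induction k with
      | zero => intro n; simpa using mem_of_mem_nhds (hW n)
      | succ k ih =>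
        intro n
        have h1 : T (s (n + 1 + k)) - T (s (n + 1)) ∈ W (n + 1) := ih (n + 1)
        have h2 : T (s (n + 1)) - T (s n) ∈ W (n + 1) := by
          rw [← map_sub]
          have : s (n + 1) - s n = g (n + 1) (r n) := by
            simp only [s, hrs]; abel
          rw [this]
          exact hgW (n + 1) _ (hr n)
        have h3 := hWadd n _ h1 _ h2
        rw [show n + (k + 1) = n + 1 + k by ring]
        simpa using h3
    exact fun n k => key k n
  have hcauchy : CauchySeq fun n => T (s n) := by
    have hbU : (𝓤 E).HasBasis (fun _ : ℕ => True) fun n => {p : E × E | p.2 - p.1 ∈ b n} :=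
      hb.1.uniformity_of_nhds_zero
    refine hbU.cauchySeq_iff'.2 fun n _ => ?_
    obtain ⟨N, -, hN⟩ := hb.1.mem_iff.1 (neg_mem_nhds_zero E (hb.1.mem_of_mem (i := n) trivial))
    refine ⟨N + 1, fun m hm => ?_⟩
    obtain ⟨k, rfl⟩ := Nat.exists_eq_add_of_le hm
    have h1 := hN (hWb N (hsT (N + 1) k))
    simpa using h1
  obtain ⟨e, he⟩ := cauchySeq_tendsto_of_complete hcauchy
  have hex : e = T x := hT s x e hs he
  have h0 : s 0 = 0 := by simp [s, r]
  refine mem_preimage.2 (hex ▸ hVc.mem_of_tendsto he (Eventually.of_forall fun n => ?_))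
  have := hsT 0 n
  rw [h0, map_zero, sub_zero, zero_add] at this
  exact this

end ClosedGraph

end FunctionSpace

/-! ### Bounded sets and supports of seminorms on `C(X)`. -/

namespace FunctionSpace

open Filter Set Topology

variable {X : Type*} [TopologicalSpace X]

/-- Condenses countably many functions into one, by the Weierstrass test; the uniform tail bound
carries properties of finite sums over to `H`. -/
theorem exists_weighted_sum (h : ℕ → C(X, ℝ)) (h0 : ∀ i x, 0 ≤ h i x) (h1 : ∀ i x, h i x ≤ 1) :
    ∃ H : C(X, ℝ), (∀ x, 0 ≤ H x) ∧ (∀ i x, 0 < h i x → 0 < H x) ∧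
      ∀ N x, |H x - ∑ i ∈ Finset.range N, (1 / 2 : ℝ) ^ i * h i x| ≤ 2 * (1 / 2) ^ N := by
  have hle : ∀ i x, (1 / 2 : ℝ) ^ i * h i x ≤ (1 / 2) ^ i := fun i x =>
    mul_le_of_le_one_right (by positivity) (h1 i x)
  have hnn : ∀ i x, 0 ≤ (1 / 2 : ℝ) ^ i * h i x := fun i x => mul_nonneg (by positivity) (h0 i x)
  have hs : ∀ x, Summable fun i => (1 / 2 : ℝ) ^ i * h i x := fun x =>
    Summable.of_nonneg_of_le (fun i => hnn i x) (fun i => hle i x) summable_geometric_two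
  have hcont : Continuous fun x => ∑' i, (1 / 2 : ℝ) ^ i * h i x := by
    refine continuous_tsum (fun i => by fun_prop) summable_geometric_two fun i x => ?_
    rw [Real.norm_of_nonneg (hnn i x)]
    exact hle i x
  refine ⟨⟨_, hcont⟩, fun x => tsum_nonneg fun i => hnn i x, fun i x hi => ?_, fun N x => ?_⟩
  · exact (hs x).tsum_pos (fun i => hnn i x) i (by positivity)
  · change |(∑' i, (1 / 2 : ℝ) ^ i * h i x) - _| ≤ _
    rw [← (hs x).sum_add_tsum_nat_add N, add_sub_cancel_left,
      abs_of_nonneg (tsum_nonneg fun i => hnn _ x)]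
    have hg : HasSum (fun i => (1 / 2 : ℝ) ^ (i + N)) (2 * (1 / 2) ^ N) := by
      simpa [pow_add] using hasSum_geometric_two.mul_right ((1 / 2 : ℝ) ^ N)
    rw [← hg.tsum_eq]
    exact Summable.tsum_le_tsum (fun i => hle _ x)
      ((summable_nat_add_iff (f := fun i => (1 / 2 : ℝ) ^ i * h i x) N).2 (hs x)) hg.summable

/-- A closed subset of a Lindelöf Tychonoff space on which every continuous real-valued function is
bounded is compact. -/
theorem isCompact_of_forall_bounded [CompletelyRegularSpace X] [LindelofSpace X] {S : Set X}
    (hS : IsClosed S) (hb : ∀ g : C(X, ℝ), ∃ M, ∀ x ∈ S, |g x| ≤ M) : IsCompact S := by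
  refine isCompact_iff_ultrafilter_le_nhds.2 fun 𝒰 h𝒰 => ?_
  by_contra! hcon
  have hS𝒰 : S ∈ 𝒰 := le_principal_iff.1 h𝒰
  have hne : ∀ x, ¬ (𝒰 : Filter X) ≤ 𝓝 x := fun x hx =>
    hcon x (hS.mem_of_frequently_of_tendsto (f := id) (b := 𝒰)
      (Eventually.frequently hS𝒰) hx) hx
  have hsep : ∀ x, ∃ h : C(X, ℝ), (∀ y, 0 ≤ h y) ∧ (∀ y, h y ≤ 1) ∧ 0 < h x ∧
      ∀ᶠ y in (𝒰 : Filter X), h y = 0 := by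
    intro x
    obtain ⟨U, hxU, hU⟩ := Filter.not_le.1 (hne x)
    obtain ⟨V, hVU, hV, hxV⟩ := mem_nhds_iff.1 hxU
    obtain ⟨f, hf, hfx, hfV⟩ := CompletelyRegularSpace.completely_regular_isOpen x V hV hxV
    refine ⟨⟨fun y => 1 - (f y : ℝ), by fun_prop⟩, fun y => ?_, fun y => ?_, ?_, ?_⟩
    · simpa using (f y).2.2
    · simpa using (f y).2.1
    · simp [hfx]
    · have hUc : Uᶜ ∈ 𝒰 := Ultrafilter.compl_mem_iff_notMem.2 hU
      filter_upwards [hUc] with y hy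
      simp [hfV (compl_subset_compl.2 hVU hy)]
  choose h h0 h1 hpos hz using hsep
  obtain ⟨t, ht, hcov⟩ := LindelofSpace.elim_nhds_subcover (fun x => {y | 0 < h x y})
    fun x => (isOpen_lt continuous_const (h x).continuous).mem_nhds (hpos x)
  have htne : t.Nonempty := by
    obtain ⟨x, -⟩ := 𝒰.nonempty_of_mem hS𝒰
    have : x ∈ ⋃ x ∈ t, {y | 0 < h x y} := hcov ▸ mem_univ x
    obtain ⟨y, hy, -⟩ := mem_iUnion₂.1 this
    exact ⟨y, hy⟩
  obtain ⟨u, rfl⟩ := ht.exists_eq_range htne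
  obtain ⟨H, -, Hpos, Hsum⟩ := exists_weighted_sum (fun i => h (u i)) (fun i => h0 _) fun i => h1 _
  have Hpos' : ∀ x, 0 < H x := fun x => by
    have : x ∈ ⋃ x ∈ range u, {y | 0 < h x y} := hcov ▸ mem_univ x
    obtain ⟨_, ⟨i, rfl⟩, hy⟩ := mem_iUnion₂.1 this
    exact Hpos i x hy
  -- `H` is positive everywhere yet tends to `0` along `𝒰`, so `H⁻¹` is unbounded on `S`.
  obtain ⟨M, hM⟩ := hb ⟨fun x => (H x)⁻¹, H.continuous.inv₀ fun x => (Hpos' x).ne'⟩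
  have hpow : Tendsto (fun N : ℕ => 2 * (1 / 2 : ℝ) ^ N) atTop (𝓝 0) := by
    simpa using (tendsto_pow_atTop_nhds_zero_of_lt_one (by norm_num : (0 : ℝ) ≤ 1 / 2)
      (by norm_num)).const_mul 2
  have hMp : 0 < (|M| + 1)⁻¹ := by positivity
  obtain ⟨N, hN⟩ := (hpow.eventually_lt_const hMp).exists
  have hev : ∀ᶠ y in (𝒰 : Filter X), ∀ i ∈ Finset.range N, h (u i) y = 0 :=
    (Finset.eventually_all _).2 fun i _ => hz (u i)
  obtain ⟨y, hy, hyS⟩ := (hev.and hS𝒰).exists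
  have h2 := Hsum N y
  rw [Finset.sum_eq_zero fun i hi => by rw [hy i hi, mul_zero], sub_zero,
    abs_of_pos (Hpos' y)] at h2
  have h3 : |(H y)⁻¹| ≤ M := hM y hyS
  rw [abs_of_pos (inv_pos.2 (Hpos' y))] at h3
  have h4 : (|M| + 1) < (H y)⁻¹ := by
    rw [lt_inv_comm₀ (by positivity) (Hpos' y)]
    exact h2.trans_lt hN
  have := le_abs_self M
  linarith

/-- The bumps of radius `1 / 2` around a sequence of reals with gaps at least `1` form a
locally finite family, so that any series with these factors has a continuous sum. -/
theorem exists_bump_sum {t : ℕ → ℝ} (ht : ∀ n, t n + 1 ≤ t (n + 1)) (g : C(X, ℝ))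
    (F : ℕ → C(X, ℝ)) :
    ∃ G : C(X, ℝ), ∀ k x, max 0 (1 - 2 * |g x - t k|) * G x =
      max 0 (1 - 2 * |g x - t k|) * (max 0 (1 - 2 * |g x - t k|) * F k x) := by
  let χ : ℕ → X → ℝ := fun k x => max 0 (1 - 2 * |g x - t k|)
  have hgap : ∀ m k, t m + k ≤ t (m + k) := fun m k => by
    induction k with
    | zero => simp
    | succ k ih => have := ht (m + k); push_cast; rw [← add_assoc m]; linarith
  have hdisj : ∀ k l x, χ k x ≠ 0 → χ l x ≠ 0 → k = l := by
    have hχ : ∀ k x, χ k x ≠ 0 → |g x - t k| < 1 / 2 := fun k x hk => by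
      by_contra! hcon
      exact hk (max_eq_left (by linarith))
    have hlt : ∀ k l x, χ k x ≠ 0 → χ l x ≠ 0 → ¬ k < l := by
      intro k l x hk hl hkl
      obtain ⟨d, rfl⟩ := Nat.exists_eq_add_of_lt hkl
      have h1 := hgap k (d + 1)
      have h2 := abs_lt.1 (hχ _ _ hk)
      have h3 := abs_lt.1 (hχ _ _ hl)
      rw [add_assoc] at h3
      push_cast at h1
      have : (0 : ℝ) ≤ d := by positivity
      linarith [h2.1, h2.2, h3.1, h3.2]
    exact fun k l x hk hl => le_antisymm (not_lt.1 (hlt l k x hl hk)) (not_lt.1 (hlt k l x hk hl))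
  have hχc : ∀ k, Continuous (χ k) := fun k => by fun_prop
  have hlf : LocallyFinite fun k => Function.support fun x => χ k x * F k x := by
    intro x
    refine ⟨{y | |g y - g x| < 1}, (isOpen_lt (by fun_prop) continuous_const).mem_nhds (by simp), ?_⟩
    -- For `k ≥ N` this gives `t k > g x + 2`, while `g y < g x + 1` nearby, so the bump at `t k`
    -- vanishes there.
    obtain ⟨N, hN⟩ := exists_nat_gt (g x + 2 - t 0)
    refine (Set.finite_lt_nat N).subset fun k hk => ?_
    obtain ⟨y, hy1, hy2⟩ := hk
    by_contra! hNk
    have hNk' : N ≤ k := not_lt.1 hNk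
    apply hy1
    have h1 := hgap 0 k
    rw [zero_add] at h1
    have h2 : (N : ℝ) ≤ k := by exact_mod_cast hNk'
    have h3 := (abs_lt.1 (show |g y - g x| < 1 from hy2)).2
    have h4 : χ k y = 0 := max_eq_left (by
      have := neg_abs_le (g y - t k)
      linarith)
    simp [h4]
  have hGc : Continuous fun x => ∑ᶠ k, χ k x * F k x :=
    continuous_finsum (fun k => (hχc k).mul (F k).continuous) hlf
  refine ⟨⟨_, hGc⟩, fun k x => ?_⟩
  change χ k x * (∑ᶠ l, χ l x * F l x) = χ k x * (χ k x * F k x)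
  by_cases hk : χ k x = 0
  · simp [hk]
  · rw [finsum_eq_single _ k fun l hl => ?_]
    have : χ l x = 0 := by
      by_contra hl'
      exact hl (hdisj l k x hl' hk)
    rw [this, zero_mul]

/-- A seminorm on `C(X, ℝ)` all of whose multiples by a fixed function are bounded on uniformly
bounded functions has a closed support, on which every continuous function is bounded. -/
theorem exists_support_of_seminorm [HereditarilyLindelofSpace X] (P : Seminorm ℝ C(X, ℝ))
    (hP : ∀ f : C(X, ℝ), ∃ C : ℝ, ∀ (g : C(X, ℝ)) (M : ℝ), 0 ≤ M →
      (∀ x, |g x| ≤ M) → P (f * g) ≤ C * M) :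
    ∃ S : Set X, IsClosed S ∧ (∀ g : C(X, ℝ), ∃ M, ∀ x ∈ S, |g x| ≤ M) ∧
      ∀ f : C(X, ℝ), (∀ x ∈ S, f x = 0) → P f = 0 := by
  let I : Set C(X, ℝ) := {h | ∀ f, P (f * h) = 0}
  -- `I` is an ideal; the support is its common zero set.
  have hImul : ∀ h ∈ I, ∀ f, f * h ∈ I := fun h hh f f' => by
    rw [← mul_assoc]; exact hh _
  refine ⟨⋂ h ∈ I, {x | h x = 0}, isClosed_biInter fun h _ =>
    isClosed_eq h.continuous continuous_const, fun g => ?_, fun f hf => ?_⟩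
  · by_contra! hunb
    have hnext : ∀ r : ℝ, ∃ x ∈ ⋂ h ∈ I, {x | h x = 0}, r + 1 ≤ |g x| := fun r =>
      (hunb (r + 1)).imp fun x hx => ⟨hx.1, hx.2.le⟩
    choose nx hnxS hnx using hnext
    let q : ℕ → X := fun n => Nat.rec (nx 0) (fun _ x => nx |g x|) n
    have hqS : ∀ n, q n ∈ ⋂ h ∈ I, {x | h x = 0} := fun n => by
      cases n with
      | zero => exact hnxS 0
      | succ n => exact hnxS _
    have hq : ∀ n, |g (q n)| + 1 ≤ |g (q (n + 1))| := fun n => hnx _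
    let χ : ℕ → C(X, ℝ) := fun k => ⟨fun x => max 0 (1 - 2 * |(|g x| - |g (q k)|)|), by fun_prop⟩
    have hχI : ∀ k, χ k * χ k ∉ I := fun k hk => by
      have h1 : (χ k * χ k) (q k) = 0 := by
        have := hqS k
        simp only [mem_iInter] at this
        exact this _ hk
      simp [χ] at h1
    -- Gliding hump: `G = ∑ χ k * F k` satisfies `P (G * χ k) = k`, although `χ k ≤ 1` bounds these
    -- values by a constant.
    have hex : ∀ k, ∃ F : C(X, ℝ), P (F * (χ k * χ k)) = k := fun k => by
      obtain ⟨f, hf⟩ := not_forall.1 (hχI k)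
      refine ⟨((k : ℝ) / P (f * (χ k * χ k))) • f, ?_⟩
      rw [smul_mul_assoc, map_smul_eq_mul, Real.norm_of_nonneg (by positivity),
        div_mul_cancel₀ _ hf]
    choose F hF using hex
    obtain ⟨G, hG⟩ := exists_bump_sum hq ⟨fun x => |g x|, by fun_prop⟩ F
    obtain ⟨C, hC⟩ := hP G
    obtain ⟨k, hk⟩ := exists_nat_gt C
    have h1 : G * χ k = F k * (χ k * χ k) := by
      ext x
      have := hG k x
      change G x * χ k x = F k x * (χ k x * χ k x)
      change χ k x * G x = χ k x * (χ k x * F k x) at this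
      linarith
    have h2 := hC (χ k) 1 zero_le_one fun x => by
      change |max 0 (1 - 2 * |(|g x| - |g (q k)|)|)| ≤ 1
      rw [abs_of_nonneg (le_max_left _ _)]
      exact max_le zero_le_one (by linarith [abs_nonneg (|g x| - |g (q k)|)])
    rw [h1, hF] at h2
    linarith
  -- `I` is closed under uniform limits, so it contains a single nonnegative `H` that is positive
  -- off the support.
  · have hzero : ∀ h : C(X, ℝ), (∀ ε > 0, ∃ h' ∈ I, ∀ x, |h x - h' x| ≤ ε) → h ∈ I := by
      intro h happ f
      obtain ⟨C, hC⟩ := hP f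
      refine le_antisymm (le_of_forall_pos_le_add fun δ hδ => ?_) (apply_nonneg _ _)
      obtain ⟨h', hh', hε⟩ := happ (δ / (|C| + 1)) (by positivity)
      have h1 : P (f * (h - h')) ≤ C * (δ / (|C| + 1)) := hC _ _ (by positivity) hε
      have h2 : f * h = f * (h - h') + f * h' := by ring
      have h3 : C * (δ / (|C| + 1)) ≤ δ := by
        rw [mul_div_assoc', div_le_iff₀ (by positivity)]
        nlinarith [le_abs_self C]
      calc P (f * h) ≤ P (f * (h - h')) + P (f * h') := by rw [h2]; exact map_add_le_add P _ _
        _ ≤ 0 + δ := by rw [hh' f]; linarith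
    have hI0 : (0 : C(X, ℝ)) ∈ I := fun f => by simp
    have hIadd : ∀ h ∈ I, ∀ h' ∈ I, h + h' ∈ I := fun h hh h' hh' f => by
      refine le_antisymm ?_ (apply_nonneg _ _)
      rw [mul_add]
      exact (map_add_le_add P _ _).trans (by rw [hh f, hh' f, add_zero])
    obtain ⟨H, hHI, hH0, hHpos⟩ : ∃ H ∈ I, (∀ x, 0 ≤ H x) ∧
        ∀ x, x ∉ ⋂ h ∈ I, {x | h x = 0} → 0 < H x := by
      obtain ⟨t, ht, hcov⟩ := eq_open_union_countable
        (fun h : I => {x | (h : C(X, ℝ)) x ≠ 0})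
        fun h => isOpen_ne_fun h.1.continuous continuous_const
      have hx : ∀ x, x ∉ ⋂ h ∈ I, {x | h x = 0} → ∃ h ∈ t, h.1 x ≠ 0 := fun x hx => by
        have h1 : x ∈ ⋃ h : I, {x | (h : C(X, ℝ)) x ≠ 0} := by
          simp only [mem_iInter, not_forall] at hx
          obtain ⟨h, hh, hhx⟩ := hx
          exact mem_iUnion.2 ⟨⟨h, hh⟩, hhx⟩
        rw [← hcov] at h1
        obtain ⟨h, hh, hhx⟩ := mem_iUnion₂.1 h1
        exact ⟨h, hh, hhx⟩
      rcases t.eq_empty_or_nonempty with rfl | htne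
      · exact ⟨0, hI0, fun x => le_rfl, fun x hxS => by simpa using hx x hxS⟩
      obtain ⟨u, rfl⟩ := ht.exists_eq_range htne
      -- A multiple of `u i`, hence in `I`, with the same zeros and values in `[0, 1]`.
      let v : ℕ → C(X, ℝ) := fun i => ⟨fun x => (u i).1 x / (1 + (u i).1 x ^ 2) * (u i).1 x,
        ((u i).1.continuous.div (by fun_prop) fun x => by positivity).mul (u i).1.continuous⟩
      have hv : ∀ i x, v i x = (u i).1 x ^ 2 / (1 + (u i).1 x ^ 2) := fun i x => by
        change (u i).1 x / (1 + (u i).1 x ^ 2) * (u i).1 x = _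
        ring
      have hvI : ∀ i, v i ∈ I := fun i => hImul _ (u i).2
        ⟨fun x => (u i).1 x / (1 + (u i).1 x ^ 2),
          (u i).1.continuous.div (by fun_prop) fun x => by positivity⟩
      obtain ⟨H, H0, Hpos, Hsum⟩ := exists_weighted_sum v
        (fun i x => by rw [hv]; positivity)
        fun i x => by rw [hv, div_le_one (by positivity)]; linarith
      refine ⟨H, hzero H fun ε hε => ?_, H0, fun x hxS => ?_⟩
      · have hpow : Tendsto (fun N : ℕ => 2 * (1 / 2 : ℝ) ^ N) atTop (𝓝 0) := by
          simpa using (tendsto_pow_atTop_nhds_zero_of_lt_one (by norm_num : (0 : ℝ) ≤ 1 / 2)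
            (by norm_num)).const_mul 2
        obtain ⟨N, hN⟩ := (hpow.eventually_lt_const hε).exists
        refine ⟨∑ i ∈ Finset.range N, ContinuousMap.const X ((1 / 2 : ℝ) ^ i) * v i, ?_, fun x => ?_⟩
        · exact Finset.sum_induction _ (· ∈ I) (fun a b ha hb => hIadd a ha b hb) hI0
            fun i _ => hImul _ (hvI i) _
        · refine le_trans (le_of_eq ?_) ((Hsum N x).trans hN.le)
          simp [ContinuousMap.sum_apply]
      · obtain ⟨_, ⟨i, rfl⟩, hi⟩ := hx x hxS
        refine Hpos i x ?_
        rw [hv]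
        positivity
    obtain ⟨C, hC⟩ := hP 1
    refine le_antisymm (le_of_forall_pos_le_add fun δ hδ => ?_) (apply_nonneg _ _)
    set ε := δ / (|C| + 1) with hεdef
    have hε : 0 < ε := by positivity
    have hpos : ∀ x, 0 < H x + max 0 (ε - |f x|) := fun x => by
      by_cases hx : x ∈ ⋂ h ∈ I, {x | h x = 0}
      · rw [hf x hx]
        have := hH0 x
        simp only [abs_zero, sub_zero]
        have := le_max_right 0 ε
        linarith
      · have := hHpos x hx
        have := le_max_left 0 (ε - |f x|)
        linarith
    have hc : Continuous fun x => f x / (H x + max 0 (ε - |f x|)) :=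
      f.continuous.div (by fun_prop) fun x => (hpos x).ne'
    let a : C(X, ℝ) := ⟨_, hc⟩
    let w : C(X, ℝ) := ⟨fun x => max 0 (ε - |f x|), by fun_prop⟩
    -- The first term lies in `I`; the second is at most `ε` because `w` vanishes where `|f| ≥ ε`.
    have hfa : f = a * H + 1 * (a * w) := by
      ext x
      change f x = f x / (H x + max 0 (ε - |f x|)) * H x +
        1 * (f x / (H x + max 0 (ε - |f x|)) * max 0 (ε - |f x|))
      have := (hpos x).ne'
      field_simp
    have hsmall : ∀ x, |(a * w) x| ≤ ε := fun x => by
      change |f x / (H x + max 0 (ε - |f x|)) * max 0 (ε - |f x|)| ≤ ε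
      rcases le_total ε |f x| with hle | hle
      · rw [max_eq_left (by linarith), mul_zero, abs_zero]
        exact hε.le
      · have hw : 0 ≤ max 0 (ε - |f x|) := le_max_left _ _
        rw [abs_mul, abs_div, abs_of_pos (hpos x), abs_of_nonneg hw, div_mul_eq_mul_div,
          div_le_iff₀ (hpos x)]
        have := mul_le_mul_of_nonneg_right hle hw
        nlinarith [mul_nonneg hε.le (hH0 x)]
    have h3 : C * ε ≤ δ := by
      rw [hεdef, mul_div_assoc', div_le_iff₀ (by positivity)]
      nlinarith [le_abs_self C]
    calc P f ≤ P (a * H) + P (1 * (a * w)) := by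
          conv_lhs => rw [hfa]
          exact map_add_le_add P _ _
      _ ≤ 0 + δ := by rw [hHI a]; linarith [hC (a * w) ε hε.le hsmall]

end FunctionSpace

/-! ### Polars of neighbourhoods of zero. -/

namespace FunctionSpace

open Filter Set Topology

theorem exists_continuous_seminorm_subset {E : Type*} [AddCommGroup E] [Module ℝ E]
    [TopologicalSpace E] [IsTopologicalAddGroup E] [ContinuousSMul ℝ E] [LocallyConvexSpace ℝ E]
    {U : Set E} (hU : U ∈ 𝓝 0) : ∃ p : Seminorm ℝ E, Continuous p ∧ {e | p e < 1} ⊆ U := by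
  obtain ⟨V, ⟨hV0, hVo, hVb, hVc⟩, hVU⟩ := (nhds_hasBasis_absConvex_open ℝ E).mem_iff.1 hU
  have hb := gaugeSeminormFamily_ball (𝕜 := ℝ) (E := E) ⟨V, hV0, hVo, hVb, hVc⟩
  refine ⟨gaugeSeminormFamily ℝ E ⟨V, hV0, hVo, hVb, hVc⟩,
    (with_gaugeSeminormFamily (𝕜 := ℝ) (E := E)).continuous_seminorm _, fun e he => hVU ?_⟩
  have : e ∈ (gaugeSeminormFamily ℝ E ⟨V, hV0, hVo, hVb, hVc⟩).ball 0 1 := by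
    rw [Seminorm.ball_zero_eq]; exact he
  rw [hb] at this
  exact this

variable {X E : Type*} [TopologicalSpace X] [AddCommGroup E] [Module ℝ E]

/-- The points of `X` whose evaluation functional is in the polar of `U`. -/
def polarPoints (Φ : E ≃ₗ[ℝ] C(X, ℝ)) (U : Set E) : Set X := {x | ∀ e ∈ U, |Φ e x| ≤ 1}

theorem isClosed_polarPoints (Φ : E ≃ₗ[ℝ] C(X, ℝ)) (U : Set E) : IsClosed (polarPoints Φ U) := by
  simp only [polarPoints, ofPred_forall]
  exact isClosed_biInter fun e _ => isClosed_le (by fun_prop) continuous_const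

theorem polarPoints_anti (Φ : E ≃ₗ[ℝ] C(X, ℝ)) : Antitone (polarPoints Φ) :=
  fun _ _ h _ hx e he => hx e (h he)

variable [TopologicalSpace E] [ContinuousSMul ℝ E] {Φ : E ≃ₗ[ℝ] C(X, ℝ)}

theorem bounded_on_polarPoints {U : Set E} (hU : U ∈ 𝓝 0) (g : C(X, ℝ)) :
    ∃ M, ∀ x ∈ polarPoints Φ U, |g x| ≤ M := by
  have h0 : Tendsto (fun n : ℕ => ((n : ℝ) + 1)⁻¹ • Φ.symm g) atTop (𝓝 0) := by
    have := (tendsto_one_div_add_atTop_nhds_zero_nat (𝕜 := ℝ)).smul_const (Φ.symm g)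
    simpa using this
  obtain ⟨n, hn⟩ := (h0.eventually hU).exists
  refine ⟨(n : ℝ) + 1, fun x hx => ?_⟩
  have hpos : (0 : ℝ) < (n : ℝ) + 1 := by positivity
  have h1 := hx _ hn
  simp only [map_smul, LinearEquiv.apply_symm_apply, ContinuousMap.smul_apply, smul_eq_mul,
    abs_mul, abs_inv, abs_of_pos hpos] at h1
  rwa [inv_mul_le_iff₀ hpos, mul_one] at h1

theorem exists_dense_approx [IsTopologicalAddGroup E] {U : Set E} (hU : U ∈ 𝓝 0) {D : ℕ → E} (hD : DenseRange D)
    (g : C(X, ℝ)) : ∃ i, ∀ x ∈ polarPoints Φ U, |g x - Φ (D i) x| ≤ 1 / 4 := by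
  have hN : (fun d => (4 : ℝ) • (Φ.symm g - d)) ⁻¹' U ∈ 𝓝 (Φ.symm g) := by
    have hc : Continuous fun d => (4 : ℝ) • (Φ.symm g - d) := by fun_prop
    exact hc.continuousAt.preimage_mem_nhds (by simpa using hU)
  obtain ⟨i, hi⟩ := hD.exists_mem_open isOpen_interior ⟨_, mem_interior_iff_mem_nhds.2 hN⟩
  refine ⟨i, fun x hx => ?_⟩
  have hiU : (4 : ℝ) • (Φ.symm g - D i) ∈ U :=
    mem_preimage.1 (interior_subset (s := (fun d => (4 : ℝ) • (Φ.symm g - d)) ⁻¹' U) hi)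
  have h1 := hx _ hiU
  simp only [map_smul, map_sub, LinearEquiv.apply_symm_apply, ContinuousMap.smul_apply,
    ContinuousMap.sub_apply, smul_eq_mul, abs_mul] at h1
  rw [abs_of_pos (by norm_num : (0 : ℝ) < 4)] at h1
  linarith

/-- A function equal to `0` at `x` and `1` off a neighbourhood is approximated within `1 / 4` by a
member of the dense sequence, whose values there still differ by at least `1 / 2`. Hence countably
many functions induce the topology. -/
theorem secondCountableTopology_polarPoints [IsTopologicalAddGroup E] [CompletelyRegularSpace X]
    [TopologicalSpace.SeparableSpace E] {U : Set E} (hU : U ∈ 𝓝 0) :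
    SecondCountableTopology (polarPoints Φ U) := by
  let D := TopologicalSpace.denseSeq E
  let ι : polarPoints Φ U → ℕ → ℝ := fun x i => Φ (D i) x
  have hι : IsInducing ι := by
    have hc : Continuous ι := continuous_pi fun i => by fun_prop
    refine isInducing_iff_nhds.2 fun x => le_antisymm (hc.tendsto x).le_comap ?_
    intro W hW
    obtain ⟨W', hW', hWW⟩ := mem_nhds_subtype _ _ _ |>.1 hW
    obtain ⟨V, hVW, hV, hxV⟩ := mem_nhds_iff.1 hW'
    obtain ⟨f, hf, hfx, hfV⟩ := CompletelyRegularSpace.completely_regular_isOpen (x : X) V hV hxV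
    obtain ⟨i, hi⟩ := exists_dense_approx (Φ := Φ) hU (TopologicalSpace.denseRange_denseSeq E)
      ⟨fun y => (f y : ℝ), by fun_prop⟩
    have hO : {s : ℕ → ℝ | |s i - ι x i| < 1 / 4} ∈ 𝓝 (ι x) :=
      (isOpen_lt (by fun_prop) continuous_const).mem_nhds (by simp)
    refine ⟨_, hO, fun y hy => hWW (hVW ?_)⟩
    by_contra hyV
    have h1 : |Φ (D i) y - Φ (D i) x| < 1 / 4 := hy
    have h2 : |(f y : ℝ) - Φ (D i) y| ≤ 1 / 4 := hi y y.2
    have h3 : |(f x : ℝ) - Φ (D i) x| ≤ 1 / 4 := hi x x.2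
    rw [hfV hyV] at h2
    rw [hfx] at h3
    simp only [Pi.one_apply, Icc.coe_one, Icc.coe_zero] at h2 h3
    linarith [abs_lt.1 h1, abs_le.1 h2, abs_le.1 h3]
  exact hι.secondCountableTopology

end FunctionSpace

/-! ### From the Fréchet topology to properties of `X`. -/

namespace FunctionSpace

open Filter Set Topology

variable {X E : Type*} [TopologicalSpace X] [AddCommGroup E] [Module ℝ E]

section Topological

variable [TopologicalSpace E] {Φ : E ≃ₗ[ℝ] C(X, ℝ)}

theorem exists_mem_polarPoints (hΦ : ∀ x, Continuous fun e => Φ e x) {U : ℕ → Set E}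
    (hU : (𝓝 (0 : E)).HasBasis (fun _ => True) U) (x : X) : ∃ n, x ∈ polarPoints Φ (U n) := by
  have h : {e | |Φ e x| ≤ 1} ∈ 𝓝 (0 : E) := by
    have h1 : {e | |Φ e x| < 1} ∈ 𝓝 (0 : E) :=
      (isOpen_lt (hΦ x).abs continuous_const).mem_nhds (by simp)
    filter_upwards [h1] with e he using le_of_lt he
  obtain ⟨n, -, hn⟩ := hU.mem_iff.1 h
  exact ⟨n, fun e he => hn he⟩

theorem isSubmetrizable_of_separableSpace [T35Space X] [TopologicalSpace.SeparableSpace E]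
    (hΦ : ∀ x, Continuous fun e => Φ e x) : IsSubmetrizable X := by
  let D := TopologicalSpace.denseSeq E
  let ι : X → ℕ → ℝ := fun x i => Φ (D i) x
  have hc : Continuous ι := continuous_pi fun i => by fun_prop
  have hinj : Function.Injective ι := by
    intro x y hxy
    have hall : (fun e => Φ e x) = fun e => Φ e y :=
      (TopologicalSpace.denseRange_denseSeq E).equalizer (hΦ x) (hΦ y) (funext fun i =>
        congrFun hxy i)
    by_contra hne
    obtain ⟨f, hf, hfx, hfV⟩ := CompletelyRegularSpace.completely_regular_isOpen x {y}ᶜ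
      isOpen_compl_singleton hne
    have h1 := congrFun hall (Φ.symm ⟨fun z => (f z : ℝ), by fun_prop⟩)
    have h2 : f y = 1 := hfV (by simp)
    simp [hfx, h2] at h1
  let _ := TopologicalSpace.metrizableSpaceMetric (ℕ → ℝ)
  exact ⟨fun x y => dist (ι x) (ι y), by fun_prop,
    fun x y => dist_eq_zero.trans hinj.eq_iff, fun x y => dist_comm _ _,
    fun x y z => dist_triangle _ _ _⟩

theorem hereditarilyLindelofSpace_of_separableSpace [IsTopologicalAddGroup E]
    [ContinuousSMul ℝ E] [FirstCountableTopology E] [TopologicalSpace.SeparableSpace E]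
    [CompletelyRegularSpace X] (hΦ : ∀ x, Continuous fun e => Φ e x) :
    HereditarilyLindelofSpace X := by
  obtain ⟨U, hU⟩ := (𝓝 (0 : E)).exists_antitone_basis
  refine HereditarilyLindelofSpace.of_forall_isOpen fun s _ => ?_
  have hs : s = ⋃ n, ((↑) : polarPoints Φ (U n) → X) '' ((↑) ⁻¹' s) := by
    refine Subset.antisymm (fun x hx => ?_) (iUnion_subset fun n => image_preimage_subset _ _)
    obtain ⟨n, hn⟩ := exists_mem_polarPoints hΦ hU.1 x
    exact mem_iUnion.2 ⟨n, ⟨x, hn⟩, hx, rfl⟩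
  rw [hs]
  refine isLindelof_iUnion fun n => ?_
  have := secondCountableTopology_polarPoints (Φ := Φ) (hU.1.mem_of_mem (i := n) trivial)
  exact (HereditarilyLindelofSpace.isLindelof _).image continuous_subtype_val

theorem isCompact_polarPoints [ContinuousSMul ℝ E] [CompletelyRegularSpace X] [LindelofSpace X]
    {U : Set E} (hU : U ∈ 𝓝 0) : IsCompact (polarPoints Φ U) :=
  isCompact_of_forall_bounded (isClosed_polarPoints Φ U) (bounded_on_polarPoints hU)

/-- The supremum of `|Φ e x|` over `x ∈ C` is a pointwise finite supremum of continuous seminorms,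
hence continuous on a barrelled space. -/
theorem exists_subset_polarPoints [BarrelledSpace ℝ E] (hΦ : ∀ x, Continuous fun e => Φ e x)
    {U : ℕ → Set E} (hU : (𝓝 (0 : E)).HasBasis (fun _ => True) U) {C : Set X}
    (hC : IsCompact C) : ∃ n, C ⊆ polarPoints Φ (U n) := by
  let ev : X → E →ₗ[ℝ] ℝ := fun x =>
    { toFun := fun e => Φ e x, map_add' := by simp, map_smul' := by simp }
  let p : C → Seminorm ℝ E := fun x => (normSeminorm ℝ ℝ).comp (ev x)
  have hp : ∀ x e, p x e = |Φ e x| := fun x e => rfl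
  have hbdd : BddAbove (range p) := by
    rw [Seminorm.bddAbove_range_iff]
    intro e
    obtain ⟨M, hM⟩ := hC.exists_bound_of_continuousOn (Φ e).continuous.continuousOn
    exact ⟨M, by rintro _ ⟨x, rfl⟩; exact hM x x.2⟩
  have hcont : Continuous (⨆ x, ⇑(p x)) :=
    Seminorm.continuous_iSup p (fun x => (hΦ x).abs) hbdd
  have h0 : (⨆ x, ⇑(p x)) 0 = 0 := by rw [← Seminorm.coe_iSup_eq hbdd, map_zero]
  have hN : {e | (⨆ x, ⇑(p x)) e < 1} ∈ 𝓝 (0 : E) :=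
    (isOpen_lt hcont continuous_const).mem_nhds (by
      change (⨆ x, ⇑(p x)) 0 < 1
      rw [h0]
      exact zero_lt_one)
  obtain ⟨n, -, hn⟩ := hU.mem_iff.1 hN
  refine ⟨n, fun x hx e he => ?_⟩
  have h1 : (⨆ x, ⇑(p x)) e < 1 := hn he
  rw [iSup_apply] at h1
  rw [Seminorm.bddAbove_range_iff] at hbdd
  exact (le_ciSup (f := fun y => p y e) (hbdd e) ⟨x, hx⟩).trans h1.le

end Topological

variable [UniformSpace E] [IsUniformAddGroup E] [ContinuousSMul ℝ E] [CompleteSpace E]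
  [FirstCountableTopology E] {Φ : E ≃ₗ[ℝ] C(X, ℝ)}

/-- Multiplication by `f` from bounded functions to `E` has closed graph, since convergence on both
sides implies pointwise convergence; so it is continuous. -/
theorem exists_bound_mul [T2Space E] (hΦ : ∀ x, Continuous fun e => Φ e x) {p : Seminorm ℝ E}
    (hp : Continuous p) (f : C(X, ℝ)) : ∃ C : ℝ, ∀ (g : C(X, ℝ)) (M : ℝ), 0 ≤ M →
      (∀ x, |g x| ≤ M) → p (Φ.symm (f * g)) ≤ C * M := by
  let T : BoundedContinuousFunction X ℝ →ₗ[ℝ] E :=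
    { toFun := fun g => Φ.symm (f * g.toContinuousMap)
      map_add' := fun g h => by
        rw [← map_add, ← mul_add]; rfl
      map_smul' := fun c g => by
        rw [RingHom.id_apply, ← map_smul, ← mul_smul_comm]; rfl }
  have hT : Continuous T := by
    refine continuous_of_seq_closed_graph T fun u b e hu he => Φ.injective ?_
    ext x
    have h1 : Tendsto (fun n => f x * u n x) atTop (𝓝 (Φ e x)) := by
      have := ((hΦ x).tendsto e).comp he
      refine this.congr fun n => ?_
      simp [T]
    have h2 : Tendsto (fun n => f x * u n x) atTop (𝓝 (f x * b x)) :=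
      (((continuous_eval_const x).tendsto b).comp hu).const_mul (f x)
    rw [tendsto_nhds_unique h1 h2]
    simp [T]
  obtain ⟨C, hC0, hC⟩ := (p.comp T).bound_of_continuous_normedSpace (hp.comp hT)
  refine ⟨C, fun g M hM hg => ?_⟩
  let g' : BoundedContinuousFunction X ℝ := BoundedContinuousFunction.ofNormedAddCommGroup g
    g.continuous M hg
  have hg' : ‖g'‖ ≤ M := BoundedContinuousFunction.norm_ofNormedAddCommGroup_le _ hM _
  exact (hC g').trans (by gcongr)

/-- The support of `p` is closed and every function is bounded on it, so it is compact and lies in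
some polar. -/
theorem exists_seminorm_eq_zero_of_eqOn [T2Space E] [CompletelyRegularSpace X]
    [HereditarilyLindelofSpace X] (hΦ : ∀ x, Continuous fun e => Φ e x) {U : ℕ → Set E}
    (hU : (𝓝 (0 : E)).HasBasis (fun _ => True) U) {p : Seminorm ℝ E} (hp : Continuous p) :
    ∃ m, ∀ e, (∀ x ∈ polarPoints Φ (U m), Φ e x = 0) → p e = 0 := by
  obtain ⟨S, hS, hSb, hSp⟩ := exists_support_of_seminorm (p.comp Φ.symm.toLinearMap)
    (exists_bound_mul hΦ hp)
  have hcg : (uniformity E).IsCountablyGenerated :=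
    IsUniformAddGroup.uniformity_countably_generated
  obtain ⟨m, hm⟩ := exists_subset_polarPoints hΦ hU (isCompact_of_forall_bounded hS hSb)
  refine ⟨m, fun e he => ?_⟩
  simpa using hSp (Φ e) fun x hx => he x (hm hx)

/-- Continuous functions that stabilize on the sets `polarPoints Φ (U n)` can be glued. -/
theorem exists_glue [T2Space E] [LocallyConvexSpace ℝ E] [CompletelyRegularSpace X]
    [HereditarilyLindelofSpace X] (hΦ : ∀ x, Continuous fun e => Φ e x) {U : ℕ → Set E}
    (hU : (𝓝 (0 : E)).HasAntitoneBasis U) (f : ℕ → C(X, ℝ))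
    (hf : ∀ n, ∀ x ∈ polarPoints Φ (U n), f (n + 1) x = f n x) :
    ∃ F : C(X, ℝ), ∀ n, ∀ x ∈ polarPoints Φ (U n), F x = f n x := by
  have hmono : ∀ {m n}, m ≤ n → polarPoints Φ (U m) ⊆ polarPoints Φ (U n) :=
    fun h => polarPoints_anti Φ (hU.2 h)
  have hstab : ∀ m k, ∀ x ∈ polarPoints Φ (U m), f (m + k) x = f m x := by
    intro m k x hx
    induction k with
    | zero => rfl
    | succ k ih => rw [← add_assoc, hf _ x (hmono (Nat.le_add_right m k) hx), ih]
  have hcauchy : CauchySeq fun n => Φ.symm (f n) := by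
    refine (𝓝 (0 : E)).basis_sets.uniformity_of_nhds_zero.cauchySeq_iff'.2 fun V hV => ?_
    obtain ⟨p, hp, hpV⟩ := exists_continuous_seminorm_subset (neg_mem_nhds_zero E hV)
    obtain ⟨m, hm⟩ := exists_seminorm_eq_zero_of_eqOn hΦ hU.1 hp
    refine ⟨m, fun n hn => ?_⟩
    obtain ⟨k, rfl⟩ := Nat.exists_eq_add_of_le hn
    -- The difference vanishes on the polar that carries `p`.
    have h1 : p (Φ.symm (f (m + k)) - Φ.symm (f m)) = 0 := hm _ fun x hx => by
      simp [hstab m k x hx]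
    have h2 : Φ.symm (f (m + k)) - Φ.symm (f m) ∈ -V := hpV (by simp [h1])
    simpa using h2
  obtain ⟨e, he⟩ := cauchySeq_tendsto_of_complete hcauchy
  refine ⟨Φ e, fun n x hx => tendsto_nhds_unique (((hΦ x).tendsto e).comp he) ?_⟩
  refine tendsto_const_nhds.congr' ?_
  filter_upwards [eventually_ge_atTop n] with m hm
  obtain ⟨k, rfl⟩ := Nat.exists_eq_add_of_le hm
  simp [hstab n k x hx]

/-- Tietze on `K ∪ {x} ∪ L`: `f` and the constant `1` agree on the overlap. This is the inductive
step for the k-space property. -/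
theorem exists_extension_eq_one [NormalSpace X] {K L : Set X} (hK : IsClosed K) (hL : IsClosed L)
    {x : X} (hxL : x ∉ L) (f : C(X, ℝ)) (hfx : f x = 0) (hfL : ∀ y ∈ L ∩ K, f y = 1)
    (hx : IsClosed {x}) :
    ∃ g : C(X, ℝ), (∀ y ∈ K, g y = f y) ∧ g x = 0 ∧ ∀ y ∈ L, g y = 1 := by
  classical
  have hKx : IsClosed (K ∪ {x}) := hK.union hx
  let φ : X → ℝ := fun y => if y ∈ L then 1 else f y
  have hφK : ∀ y ∈ K ∪ {x}, φ y = f y := by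
    rintro y (hy | rfl)
    · by_cases hyL : y ∈ L
      · simp [φ, hyL, hfL y ⟨hyL, hy⟩]
      · simp [φ, hyL]
    · simp [φ, hxL]
  have hφL : ∀ y ∈ L, φ y = 1 := fun y hy => if_pos hy
  have hφ : ContinuousOn φ (K ∪ {x} ∪ L) :=
    (f.continuous.continuousOn.congr hφK).union_of_isClosed
      (continuousOn_const.congr hφL) hKx hL
  obtain ⟨g, hg⟩ := ContinuousMap.exists_restrict_eq (hKx.union hL)
    ⟨(K ∪ {x} ∪ L).domRestrict φ, hφ.domRestrict⟩
  have hg' : ∀ y ∈ K ∪ {x} ∪ L, g y = φ y := fun y hy =>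
    congrArg (fun h : C(↥(K ∪ {x} ∪ L), ℝ) => h ⟨y, hy⟩) hg
  refine ⟨g, fun y hy => ?_, ?_, fun y hy => ?_⟩
  · rw [hg' y (.inl (.inl hy)), hφK y (.inl hy)]
  · rw [hg' x (.inl (.inr rfl)), hφK x (.inr rfl), hfx]
  · rw [hg' y (.inr hy), hφL y hy]

/-- A point `x ∉ F` is separated from `F` by a glued function, `0` at `x` and `1` on `F`, extended
from one polar to the next. -/
theorem isKSpace_of_linearEquiv [LocallyConvexSpace ℝ E] [T2Space E]
    [TopologicalSpace.SeparableSpace E] [T35Space X] (hΦ : ∀ x, Continuous fun e => Φ e x) :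
    IsKSpace X := by
  have := hereditarilyLindelofSpace_of_separableSpace hΦ
  obtain ⟨U, hU⟩ := (𝓝 (0 : E)).exists_antitone_basis
  have hmono : ∀ {m n}, m ≤ n → polarPoints Φ (U m) ⊆ polarPoints Φ (U n) :=
    fun h => polarPoints_anti Φ (hU.2 h)
  intro F
  refine ⟨fun hF K _ => hF.preimage continuous_subtype_val, fun hF => ?_⟩
  have hFK : ∀ n, IsClosed (F ∩ polarPoints Φ (U n)) := fun n => by
    have hc : IsCompact (polarPoints Φ (U n)) :=
      isCompact_polarPoints (hU.1.mem_of_mem (i := n) trivial)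
    have h1 := hc.isClosed.isClosedEmbedding_subtypeVal.isClosedMap _ (hF _ hc)
    rwa [Subtype.image_preimage_coe, inter_comm] at h1
  rw [← isOpen_compl_iff, isOpen_iff_mem_nhds]
  intro x hxF
  have hstep : ∀ n (f : C(X, ℝ)), f x = 0 → (∀ y ∈ F ∩ polarPoints Φ (U n), f y = 1) →
      ∃ g : C(X, ℝ), (∀ y ∈ polarPoints Φ (U n), g y = f y) ∧ g x = 0 ∧
        ∀ y ∈ F ∩ polarPoints Φ (U (n + 1)), g y = 1 := fun n f hfx hf =>
    exists_extension_eq_one (isClosed_polarPoints Φ (U n)) (hFK (n + 1)) (fun h => hxF h.1) f hfx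
      (fun y hy => hf y ⟨hy.1.1, hy.2⟩) isClosed_singleton
  obtain ⟨f₀, -, hf₀x, hf₀⟩ := exists_extension_eq_one isClosed_empty (hFK 0)
    (fun h => hxF h.1) (0 : C(X, ℝ)) rfl (by simp) (isClosed_singleton (x := x))
  choose! s hs1 hs2 hs3 using hstep
  let f : ℕ → C(X, ℝ) := fun n => Nat.rec f₀ s n
  have hf : ∀ n, f n x = 0 ∧ ∀ y ∈ F ∩ polarPoints Φ (U n), f n y = 1 := fun n => by
    induction n with
    | zero => exact ⟨hf₀x, hf₀⟩
    | succ n ih => exact ⟨hs2 n _ ih.1 ih.2, hs3 n _ ih.1 ih.2⟩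
  obtain ⟨G, hG⟩ := exists_glue hΦ hU f fun n y hy => hs1 n _ (hf n).1 (hf n).2 y hy
  have hGx : G x = 0 := by
    obtain ⟨n, hn⟩ := exists_mem_polarPoints hΦ hU.1 x
    rw [hG n x hn, (hf n).1]
  have hGF : ∀ y ∈ F, G y = 1 := fun y hy => by
    obtain ⟨n, hn⟩ := exists_mem_polarPoints hΦ hU.1 y
    rw [hG n y hn, (hf n).2 y ⟨hy, hn⟩]
  have hO : {y | G y ≠ 1} ∈ 𝓝 x :=
    (isOpen_ne_fun G.continuous continuous_const).mem_nhds (by simp [hGx])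
  exact mem_of_superset hO fun y hy hyF => hy (hGF y hyF)

theorem isHemicompact_of_linearEquiv [T2Space E] [TopologicalSpace.SeparableSpace E]
    [CompletelyRegularSpace X] (hΦ : ∀ x, Continuous fun e => Φ e x) : IsHemicompact X := by
  have := hereditarilyLindelofSpace_of_separableSpace hΦ
  have hcg : (uniformity E).IsCountablyGenerated :=
    IsUniformAddGroup.uniformity_countably_generated
  obtain ⟨U, hU⟩ := (𝓝 (0 : E)).exists_antitone_basis
  refine ⟨range fun n => polarPoints Φ (U n), countable_range _, ?_, fun C hC => ?_⟩
  · rintro _ ⟨n, rfl⟩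
    exact isCompact_polarPoints (hU.1.mem_of_mem (i := n) trivial)
  · obtain ⟨n, hn⟩ := exists_subset_polarPoints hΦ hU.1 hC
    exact ⟨_, ⟨n, rfl⟩, hn⟩

end FunctionSpace

/-! ### The implications between the three conditions. -/

namespace FunctionSpace

open Filter Set Topology

variable {X : Type*} [TopologicalSpace X]

theorem isPolishable_of_polishSpace [PolishSpace C(X, ℝ)] :
    IsPolishable C(X, ℝ) (pointwiseTopology X) := by
  refine ⟨inferInstance, ?_, ⟨inferInstance, inferInstance, inferInstance, inferInstance, ?_⟩,
    inferInstance⟩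
  · rw [← continuous_iff_le_induced]
    exact continuous_pi fun x => by fun_prop
  · let _ : UniformSpace C(X, ℝ) := IsTopologicalAddGroup.rightUniformSpace C(X, ℝ)
    have : IsUniformAddGroup C(X, ℝ) := isUniformAddGroup_of_addCommGroup
    exact completeSpace_of_isCompletelyMetrizableSpace

theorem submetrizable_hemicompact_kSpace_of_isPolishable [T35Space X]
    (h : IsPolishable C(X, ℝ) (pointwiseTopology X)) :
    IsSubmetrizable X ∧ IsHemicompact X ∧ IsKSpace X := by
  obtain ⟨τ, hτ, hF, hs⟩ := h
  -- `Φ` is the identity: its source carries `τ`, its target the compact-open instance.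
  have hΦ : ∀ x, @Continuous _ _ τ _
      fun e => (LinearEquiv.refl ℝ C(X, ℝ)) e x := fun x => by
    have h1 := continuous_iff_le_induced.2 hτ
    exact (@continuous_apply _ _ _ x).comp h1
  have := hF.isTopologicalAddGroup
  let u : UniformSpace C(X, ℝ) := @IsTopologicalAddGroup.rightUniformSpace C(X, ℝ) _ τ this
  have hu : @IsUniformAddGroup C(X, ℝ) u _ := @isUniformAddGroup_of_addCommGroup _ _ τ this
  have hc := hF.completeSpace
  have hsm := hF.continuousSMul
  have hlc := hF.locallyConvexSpace
  have hm := hF.metrizableSpace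
  have ht2 : @T2Space _ τ := @TopologicalSpace.t2Space_of_metrizableSpace _ τ hm
  have hfc : @FirstCountableTopology _ τ := by
    let _ := @TopologicalSpace.metrizableSpaceMetric _ τ hm
    infer_instance
  refine ⟨@isSubmetrizable_of_separableSpace X C(X, ℝ) _ _ _ τ (LinearEquiv.refl ℝ _) _ hs hΦ,
    @isHemicompact_of_linearEquiv X C(X, ℝ) _ _ _ u hu hsm hc hfc (LinearEquiv.refl ℝ _)
      ht2 hs _ hΦ,
    @isKSpace_of_linearEquiv X C(X, ℝ) _ _ _ u hu hsm hc hfc (LinearEquiv.refl ℝ _)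
      hlc ht2 hs _ hΦ⟩

theorem secondCountableTopology_of_injective {K M : Type*} [TopologicalSpace K] [CompactSpace K]
    [MetricSpace M] {f : K → M} (hf : Continuous f) (hinj : Function.Injective f) :
    SecondCountableTopology K := by
  have := (hf.isClosedEmbedding hinj).isEmbedding.metrizableSpace
  let _ := TopologicalSpace.metrizableSpaceMetric K
  infer_instance

theorem secondCountableTopology_of_isSubmetrizable (h : IsSubmetrizable X) {K : Set X}
    (hK : IsCompact K) : SecondCountableTopology K := by
  obtain ⟨d, hd, hd0, hds, hdt⟩ := h
  let m : MetricSpace X :=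
    { dist := d
      dist_self := fun x => (hd0 _ _).2 rfl
      dist_comm := hds
      dist_triangle := hdt
      eq_of_dist_eq_zero := (hd0 _ _).1 }
  have hcs : CompactSpace K := isCompact_iff_compactSpace.1 hK
  have hc : @Continuous K X _ m.toUniformSpace.toTopologicalSpace (↑) := by
    refine (@Metric.continuous_iff' X K m.toPseudoMetricSpace _ _).2 fun x ε hε => ?_
    have hcx : Continuous fun y : K => d y x := by fun_prop
    exact hcx.continuousAt.eventually_lt continuousAt_const (by
      rw [(hd0 _ _).2 rfl]; exact hε)
  exact @secondCountableTopology_of_injective K X _ hcs m _ hc Subtype.val_injective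

theorem t2Space_of_isSubmetrizable (h : IsSubmetrizable X) : T2Space X := by
  obtain ⟨d, hd, hd0, -⟩ := h
  refine t2_iff_isClosed_diagonal.2 ?_
  have : diagonal X = {p : X × X | d p.1 p.2 = 0} := by
    ext p; simp [hd0, mem_diagonal_iff]
  rw [this]
  exact isClosed_eq hd continuous_const

theorem isUniformAddGroup_continuousMap : IsUniformAddGroup C(X, ℝ) :=
  let φ : C(X, ℝ) →+ UniformOnFun X ℝ {K | IsCompact K} :=
    { toFun := ContinuousMap.toUniformOnFunIsCompact
      map_zero' := rfl
      map_add' := fun _ _ => rfl }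
  IsUniformInducing.isUniformAddGroup φ
    ContinuousMap.isUniformEmbedding_toUniformOnFunIsCompact.isUniformInducing

theorem polishSpace_of_submetrizable_hemicompact_kSpace (hs : IsSubmetrizable X)
    (hh : IsHemicompact X) (hk : IsKSpace X) : PolishSpace C(X, ℝ) := by
  -- Source of completeness: a function continuous on each compact set is continuous.
  have : CompactlyCoherentSpace X := .of_isClosed fun A hA => (hk A).2 hA
  obtain ⟨𝒦, h𝒦, hc, hcof⟩ := hh
  have : Countable 𝒦 := h𝒦.to_subtype
  -- By cofinality of `𝒦`, countably many restrictions induce the topology, so second countability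
  -- passes from the `C(K, ℝ)`.
  have heq : (ContinuousMap.compactOpen : TopologicalSpace C(X, ℝ)) =
      ⨅ K : 𝒦, TopologicalSpace.induced (ContinuousMap.restrict (K : Set X))
        ContinuousMap.compactOpen := by
    refine le_antisymm (le_iInf fun K => ContinuousMap.compactOpen_le_induced _) ?_
    rw [ContinuousMap.compactOpen_eq_iInf_induced]
    refine le_iInf₂ fun C hC => ?_
    obtain ⟨K, hK, hCK⟩ := hcof C hC
    refine (iInf_le _ ⟨K, hK⟩).trans ?_
    rw [← continuous_iff_le_induced]
    have h1 : Continuous fun f : C(K, ℝ) =>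
        f.comp (⟨inclusion hCK, continuous_inclusion hCK⟩ : C(C, K)) :=
      ContinuousMap.continuous_precomp _
    exact @Continuous.comp C(X, ℝ) C(K, ℝ) C(C, ℝ) (_) _ _ (ContinuousMap.restrict K) _ h1
      continuous_induced_dom
  have hsc : SecondCountableTopology C(X, ℝ) := by
    rw [heq]
    refine TopologicalSpace.secondCountableTopology_iInf fun K => ?_
    have := secondCountableTopology_of_isSubmetrizable hs (hc K K.2)
    have : CompactSpace K := isCompact_iff_compactSpace.1 (hc K K.2)
    have := t2Space_of_isSubmetrizable hs
    exact TopologicalSpace.secondCountableTopology_induced _ _ _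
  have hug : IsUniformAddGroup C(X, ℝ) := isUniformAddGroup_continuousMap
  have hcg : (uniformity C(X, ℝ)).IsCountablyGenerated :=
    IsUniformAddGroup.uniformity_countably_generated
  infer_instance

end FunctionSpace

theorem theorem2p5 (X : Type*) [TopologicalSpace X] [T35Space X] :
    List.TFAE [
      FunctionSpace.IsPolishable C(X, ℝ) (FunctionSpace.pointwiseTopology X),
      PolishSpace C(X, ℝ),
      FunctionSpace.IsSubmetrizable X ∧ FunctionSpace.IsHemicompact X ∧
        FunctionSpace.IsKSpace X] := by
  tfae_have 1 → 3 := FunctionSpace.submetrizable_hemicompact_kSpace_of_isPolishable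
  tfae_have 3 → 2 := fun h =>
    FunctionSpace.polishSpace_of_submetrizable_hemicompact_kSpace h.1 h.2.1 h.2.2
  tfae_have 2 → 1 := fun _ => FunctionSpace.isPolishable_of_polishSpace
  tfae_finish
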